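/- Let $T,d\in\mathbb{N}$ and $\mathcal{X}=(\mathbb{R}^d)^T$ with coordinates $x=(x_{t,i})_{1\le t\le T,\,1\le i\le d}$; write $X_t(x)=x_t\in\mathbb{R}^d$ and $X_{t,i}(x)=x_{t,i}$. Let $\mathcal{P}(E)$ denote the Borel probability measures on $E$ with finite first moment, and let $\mathcal{W}_1$ be the Wasserstein distance of order $1$ on $\mathcal{P}(\mathbb{R})$. For $\check\mu=(\mu_{t,i})_{1\le t\le T,\,1\le i\le d}\in\mathcal{P}(\mathbb{R})^{dT}$ let $\Pi(\check\mu)$ be the set of $\pi\in\mathcal{P}(\mathcal{X})$ with $\pi\circ X_{t,i}^{-1}=\mu_{t,i}$ for all $t,i$; let $\mathcal{M}(\check\mu)$ be the set of $\pi\in\Pi(\check\mu)$ with $\mathbb{E}_\pi[X_{t+1}\mid X_1,\dots,X_t]=X_t$ for $1\le t\le T-1$; and for $\varepsilon\ge 0$ let $\mathcal{M}_\varepsilon(\check\mu)$ be the set of $\pi\in\Pi(\check\mu)$ with $$\mathbb{E}_\pi\Big[\big|\mathbb{E}_\pi[X_{t+1}\mid X_1,\dots,X_t]-X_t\big|\Big]\le\varepsilon,\qquad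 1\le t\le T-1,$$ where $|\cdot|$ is the $\ell_1$ norm. For $c:\mathcal{X}\to\mathbb{R}$ let $\overline{\mathsf P}(\check\mu)$ and $\underline{\mathsf P}(\check\mu)$ be the supremum and the infimum of $\int c\,d\pi$ over $\pi\in\mathcal{M}(\check\mu)$, and let $\overline{\mathsf P}_\varepsilon(\check\mu)$ and $\underline{\mathsf P}_\varepsilon(\check\mu)$ be the supremum and the infimum of $\int c\,d\pi$ over $\pi\in\mathcal{M}_\varepsilon(\check\mu)$. An optimizer is an element of the constraint set at which the supremum (respectively infimum) is attained. **Theorem.** Let $\check\mu\in\mathcal{P}(\mathbb{R})^{dT}$ satisfy $\mathcal{M}(\check\mu)\ne\emptyset$, and let $\check\mu^n=(\mu^n_{t,i})\in\mathcal{P}(\mathbb{R})^{dT}$, $n\ge1$, satisfy $\lim_{n\to\infty}r_n=0$, where $r_n:=2\max_{1\le t\le T}\sum_{i=1}^d\mathcal{W}_1(\mu^n_{t,i},\mu_{t,i})$. Then $\mathcal{M}_{r_n}(\check\mu^n)\ne\emptyset$ for all $n\ge1$. If, further, $c$ is Lipschitz and $(\varepsilon_n)_{n\ge1}$ is any sequence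 converging to zero with $\varepsilon_n\ge r_n$ for all $n\ge1$, then the following hold. (i) The values $\overline{\mathsf P}(\check\mu)$ and $\underline{\mathsf P}(\check\mu)$ are finite, and $\lim_{n\to\infty}\overline{\mathsf P}_{\varepsilon_n}(\check\mu^n)=\overline{\mathsf P}(\check\mu)$ and $\lim_{n\to\infty}\underline{\mathsf P}_{\varepsilon_n}(\check\mu^n)=\underline{\mathsf P}(\check\mu)$. (ii) For each $n\ge1$, $\overline{\mathsf P}_{\varepsilon_n}(\check\mu^n)$ (resp. $\underline{\mathsf P}_{\varepsilon_n}(\check\mu^n)$) admits an optimizer. For every choice of such optimizers $\pi_n$, the sequence $(\pi_n)_{n\ge1}$ is tight, and every limit point of it in the weak topology is an optimizer for $\overline{\mathsf P}(\check\mu)$ (resp. $\underline{\mathsf P}(\check\mu)$). In particular, if $\overline{\mathsf P}(\check\mu)$ (resp. $\underline{\mathsf P}(\check\mu)$) has a unique optimizer, then $(\pi_n)_{n\ge1}$ converges weakly to it. -/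

import Mathlib

open MeasureTheory Filter Topology
open scoped ENNReal

namespace MMOT

noncomputable section

/-- The path space `(ℝ^d)^T`; `x t i` is the `i`-th coordinate at time `t`. The times
`1, …, T` of the text are the elements `0, …, T - 1` of `Fin T`. -/
abbrev PathSpace (T d : ℕ) : Type := Fin T → Fin d → ℝ

/-- A family of probability measures on the line, one for each time and coordinate. -/
abbrev Marginals (T d : ℕ) : Type := Fin T → Fin d → ProbabilityMeasure ℝ

/-- All the marginals have a finite first moment. -/
def Marginals.FiniteFirstMoments {T d : ℕ} (μ : Marginals T d) : Prop :=
  ∀ t i, Integrable (fun y : ℝ => y) (μ t i : Measure ℝ)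

/-- Couplings: probability measures on the plane with marginals `μ` and `ν`. -/
def couplings (μ ν : ProbabilityMeasure ℝ) : Set (ProbabilityMeasure (ℝ × ℝ)) :=
  {γ | (γ : Measure (ℝ × ℝ)).map Prod.fst = μ ∧ (γ : Measure (ℝ × ℝ)).map Prod.snd = ν}

/-- The Wasserstein distance of order one, with values in `[0, ∞]`. -/
def wasserstein (μ ν : ProbabilityMeasure ℝ) : ℝ≥0∞ :=
  ⨅ γ ∈ couplings μ ν, ∫⁻ p, ENNReal.ofReal |p.1 - p.2| ∂(γ : Measure (ℝ × ℝ))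

/-- `2 max_t ∑_i W₁(ν_{t,i}, μ_{t,i})`. The Wasserstein distances are finite for measures with
finite first moments. -/
def discrepancy {T d : ℕ} (ν μ : Marginals T d) : ℝ :=
  2 * ⨆ t, ∑ i, (wasserstein (ν t i) (μ t i)).toReal

/-- The laws on path space with a finite first moment and one-dimensional marginals `μ`. -/
def transportPlans {T d : ℕ} (μ : Marginals T d) : Set (ProbabilityMeasure (PathSpace T d)) :=
  {π | Integrable (fun x => x) (π : Measure (PathSpace T d)) ∧
    ∀ t i, (π : Measure (PathSpace T d)).map (fun x => x t i) = μ t i}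

/-- The `i`-th coordinate of `E_π[X_t | X_1, …, X_s]`. -/
def condMean {T d : ℕ} (π : ProbabilityMeasure (PathSpace T d)) (s t : Fin T) (i : Fin d) :
    PathSpace T d → ℝ :=
  (π : Measure (PathSpace T d))[fun x => x t i |
    Filtration.piLE (X := fun _ : Fin T => Fin d → ℝ) s]

/-- The transport plans under which the coordinate process is a martingale. -/
def martingalePlans {T d : ℕ} (μ : Marginals T d) : Set (ProbabilityMeasure (PathSpace T d)) :=
  {π | π ∈ transportPlans μ ∧ ∀ s t : Fin T, (s : ℕ) + 1 = (t : ℕ) →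
    ∀ i, condMean π s t i =ᵐ[(π : Measure (PathSpace T d))] fun x => x s i}

/-- The transport plans for which each expected `ℓ¹`-deviation from the martingale property
is at most `ε`. -/
def relaxedPlans {T d : ℕ} (ε : ℝ) (μ : Marginals T d) :
    Set (ProbabilityMeasure (PathSpace T d)) :=
  {π | π ∈ transportPlans μ ∧ ∀ s t : Fin T, (s : ℕ) + 1 = (t : ℕ) →
    ∫ x, ∑ i, |condMean π s t i x - x s i| ∂(π : Measure (PathSpace T d)) ≤ ε}

/-- The supremum of `∫ c dπ` over `π ∈ S`, in the extended reals. -/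
def upperValue {T d : ℕ} (c : PathSpace T d → ℝ)
    (S : Set (ProbabilityMeasure (PathSpace T d))) : EReal :=
  ⨆ π ∈ S, ((∫ x, c x ∂(π : Measure (PathSpace T d)) : ℝ) : EReal)

/-- The infimum of `∫ c dπ` over `π ∈ S`, in the extended reals. -/
def lowerValue {T d : ℕ} (c : PathSpace T d → ℝ)
    (S : Set (ProbabilityMeasure (PathSpace T d))) : EReal :=
  ⨅ π ∈ S, ((∫ x, c x ∂(π : Measure (PathSpace T d)) : ℝ) : EReal)

/-- `π` attains the supremum of `∫ c dπ` over `S`. -/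
def IsMaximizer {T d : ℕ} (c : PathSpace T d → ℝ)
    (S : Set (ProbabilityMeasure (PathSpace T d))) (π : ProbabilityMeasure (PathSpace T d)) :
    Prop :=
  π ∈ S ∧ ((∫ x, c x ∂(π : Measure (PathSpace T d)) : ℝ) : EReal) = upperValue c S

/-- `π` attains the infimum of `∫ c dπ` over `S`. -/
def IsMinimizer {T d : ℕ} (c : PathSpace T d → ℝ)
    (S : Set (ProbabilityMeasure (PathSpace T d))) (π : ProbabilityMeasure (PathSpace T d)) :
    Prop :=
  π ∈ S ∧ ((∫ x, c x ∂(π : Measure (PathSpace T d)) : ℝ) : EReal) = lowerValue c S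

end

end MMOT

/-!
By duality with bounded continuous test functions, `E|E[X_{t+1} | X_1, …, X_t] - X_t| ≤ ε` says
that `E[φ(X_1, …, X_t) · (X_{t+1} - X_t)] ≤ ε` for all such `φ` with values in the unit ball of
`ℓ^∞`. Convergence of the marginals in `𝒲₁` makes their first moments converge, so functions of
linear growth can be integrated in the weak limit, and limit points of `ε_n`-martingale plans are
`ε`-martingale plans with `ε = lim ε_n`. The relaxed plans with given marginals form a compact set
for the same reason.

Conversely, given a martingale plan `π`, let each coordinate `X_{t,i}` move along an optimal
coupling of its marginals, randomized by a single uniform variable independent of `X`. Given this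
variable, the past of the new process `Y` is a function of the past of `X`, hence orthogonal to the
increments of `X`. The law of `Y` is therefore a martingale plan up to the error
`E|Y_{t+1} - X_{t+1}| + E|Y_t - X_t| ≤ r_n`, and it converges weakly to `π`. Together with the
closedness above, this gives the convergence of values and optimizers.
-/

open scoped NNReal BoundedContinuousFunction

namespace MMOT

section WeakConvergence

variable {Ω ι : Type*} [TopologicalSpace Ω] [MeasurableSpace Ω] [OpensMeasurableSpace Ω]
  {F : Filter ι} {π : ι → ProbabilityMeasure Ω} {ρ : ProbabilityMeasure Ω}

lemma lowerSemicontinuous_lintegral {f : Ω → ℝ≥0} (hf : Continuous f) :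
    LowerSemicontinuous fun π : ProbabilityMeasure Ω => ∫⁻ x, f x ∂(π : Measure Ω) := by
  have hsup : ∀ π : ProbabilityMeasure Ω, ∫⁻ x, f x ∂(π : Measure Ω) =
      ⨆ M : ℕ, ∫⁻ x, (min (f x) M : ℝ≥0) ∂(π : Measure Ω) := fun π => by
    rw [← lintegral_iSup (fun M => by fun_prop) fun M N hMN x => by dsimp only; gcongr]
    refine lintegral_congr fun x => le_antisymm ?_ (iSup_le fun M => by simp)
    obtain ⟨M, hM⟩ := exists_nat_ge (f x)
    exact le_iSup_of_le M (by rw [min_eq_left hM])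
  simp only [hsup]
  refine lowerSemicontinuous_iSup fun M => Continuous.lowerSemicontinuous ?_
  let fM : Ω →ᵇ ℝ≥0 := .mkOfBound ⟨fun x => min (f x) M, by fun_prop⟩ M fun x y =>
    abs_sub_le_of_nonneg_of_le (NNReal.coe_nonneg _) (by exact_mod_cast min_le_right _ _)
      (NNReal.coe_nonneg _) (by exact_mod_cast min_le_right _ _)
  exact continuous_iff_continuousAt.2 fun π =>
    ProbabilityMeasure.tendsto_iff_forall_lintegral_tendsto.1 tendsto_id fM

lemma eventually_lt_integral (hπ : Tendsto π F (𝓝 ρ)) {f : Ω → ℝ} (hf : Continuous f)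
    (hf0 : 0 ≤ f) (hρ : Integrable f (ρ : Measure Ω))
    (hi : ∀ᶠ n in F, Integrable f (π n : Measure Ω)) {a : ℝ}
    (ha : a < ∫ x, f x ∂(ρ : Measure Ω)) :
    ∀ᶠ n in F, a < ∫ x, f x ∂(π n : Measure Ω) := by
  have key : ∀ κ : ProbabilityMeasure Ω, Integrable f (κ : Measure Ω) →
      ∫⁻ x, (f x).toNNReal ∂(κ : Measure Ω) = ENNReal.ofReal (∫ x, f x ∂(κ : Measure Ω)) :=
    fun κ hκ => (ofReal_integral_eq_lintegral_ofReal hκ (ae_of_all _ hf0)).symm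
  rcases lt_or_ge a 0 with ha0 | ha0
  · exact .of_forall fun n => ha0.trans_le (integral_nonneg hf0)
  have h : ∀ᶠ n in F, ENNReal.ofReal a < ∫⁻ x, (f x).toNNReal ∂(π n : Measure Ω) :=
    hπ.eventually (lowerSemicontinuous_lintegral (continuous_real_toNNReal.comp hf) ρ _
      ((ENNReal.ofReal_lt_ofReal_iff_of_nonneg ha0).2 ha |>.trans_eq (key ρ hρ).symm))
  filter_upwards [h, hi] with n hn hin
  exact (ENNReal.ofReal_lt_ofReal_iff_of_nonneg ha0).1 (hn.trans_eq (key _ hin))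

lemma eventually_lt_integral_of_abs_le (hπ : Tendsto π F (𝓝 ρ)) {f G : Ω → ℝ}
    (hf : Continuous f) (hG : Continuous G) (hfG : ∀ x, |f x| ≤ G x)
    (hρ : Integrable G (ρ : Measure Ω)) (hi : ∀ᶠ n in F, Integrable G (π n : Measure Ω))
    (hlim : Tendsto (fun n => ∫ x, G x ∂(π n : Measure Ω)) F (𝓝 (∫ x, G x ∂(ρ : Measure Ω))))
    {a : ℝ} (ha : a < ∫ x, f x ∂(ρ : Measure Ω)) :
    ∀ᶠ n in F, a < ∫ x, f x ∂(π n : Measure Ω) := by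
  have hfi : ∀ {κ : Measure Ω}, Integrable G κ → Integrable f κ := fun h =>
    h.mono' hf.measurable.aestronglyMeasurable (ae_of_all _ hfG)
  obtain ⟨b, hab, hb⟩ := exists_between ha
  have hsum : ∀ᶠ n in F, (∫ x, G x ∂(ρ : Measure Ω)) + b < ∫ x, (G x + f x) ∂(π n : Measure Ω) :=
    eventually_lt_integral hπ (hG.add hf)
      (fun x => neg_le_iff_add_nonneg'.1 (neg_le_of_abs_le (hfG x))) (hρ.add (hfi hρ))
      (hi.mono fun n hn => hn.add (hfi hn))
      (by rw [integral_add' hρ (hfi hρ)]; gcongr)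
  filter_upwards [hsum, hi, hlim.eventually_lt_const (lt_add_of_pos_right _ (sub_pos.2 hab))]
    with n h1 h2 h3
  rw [integral_add h2 (hfi h2)] at h1
  linarith

lemma tendsto_integral_of_abs_le (hπ : Tendsto π F (𝓝 ρ)) {f G : Ω → ℝ}
    (hf : Continuous f) (hG : Continuous G) (hfG : ∀ x, |f x| ≤ G x)
    (hρ : Integrable G (ρ : Measure Ω)) (hi : ∀ᶠ n in F, Integrable G (π n : Measure Ω))
    (hlim : Tendsto (fun n => ∫ x, G x ∂(π n : Measure Ω)) F (𝓝 (∫ x, G x ∂(ρ : Measure Ω)))) :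
    Tendsto (fun n => ∫ x, f x ∂(π n : Measure Ω)) F (𝓝 (∫ x, f x ∂(ρ : Measure Ω))) := by
  refine tendsto_order.2 ⟨fun a ha =>
    eventually_lt_integral_of_abs_le hπ hf hG hfG hρ hi hlim ha, fun a ha => ?_⟩
  have := eventually_lt_integral_of_abs_le hπ hf.neg hG (fun x => by simpa using hfG x)
    hρ hi hlim (a := -a) (by simpa [integral_neg] using ha)
  simpa [integral_neg] using this

lemma isClosed_setOf_map_eq {Ω' : Type*} [TopologicalSpace Ω'] [HasOuterApproxClosed Ω']
    [MeasurableSpace Ω'] [BorelSpace Ω'] {f : Ω → Ω'} (hf : Continuous f)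
    (ν : ProbabilityMeasure Ω') :
    IsClosed {π : ProbabilityMeasure Ω | (π : Measure Ω).map f = ν} := by
  convert! (isClosed_singleton (x := ν)).preimage (ProbabilityMeasure.continuous_map hf) using 1
  ext π
  exact (Subtype.ext_iff (a1 := π.map hf.aemeasurable) (a2 := ν)).symm

end WeakConvergence

lemma tendsto_of_abs_integral_sub_le {Ω ι : Type*} [PseudoEMetricSpace Ω] [MeasurableSpace Ω]
    [OpensMeasurableSpace Ω] {F : Filter ι} {π : ι → ProbabilityMeasure Ω}
    {ρ : ProbabilityMeasure Ω} {g : ι → ℝ} (hg : Tendsto g F (𝓝 0))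
    (h : ∀ n (f : Ω → ℝ) (L : ℝ≥0), LipschitzWith L f →
      |∫ x, f x ∂(π n : Measure Ω) - ∫ x, f x ∂(ρ : Measure Ω)| ≤ L * g n) :
    Tendsto π F (𝓝 ρ) := by
  -- the criterion by Lipschitz functions is available along countably generated filters
  refine Tendsto.mono_left ?_ hg.le_comap
  refine tendsto_iff_forall_lipschitz_integral_tendsto.2 fun f _ ⟨L, hL⟩ => ?_
  refine tendsto_iff_dist_tendsto_zero.2 (squeeze_zero (fun _ => dist_nonneg) (fun n => h n f L hL)
    ?_)
  simpa using (tendsto_comap (f := g) (x := 𝓝 0)).const_mul (L : ℝ)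

section FirstMoment

variable {E : Type*} [NormedAddCommGroup E] [ProperSpace E] [MeasurableSpace E] [BorelSpace E]
  {C : ℝ≥0∞}

lemma isTightMeasureSet_setOf_lintegral_enorm_le (hC : C ≠ ⊤) :
    IsTightMeasureSet {κ : Measure E | ∫⁻ x, ‖x‖ₑ ∂κ ≤ C} := by
  refine isTightMeasureSet_of_tendsto_measure_norm_gt ?_
  have hlim : Tendsto (fun r : ℝ => C / ENNReal.ofReal r) atTop (𝓝 0) := by
    simpa using ENNReal.Tendsto.const_div ENNReal.tendsto_ofReal_atTop (.inr hC)
  refine tendsto_of_tendsto_of_tendsto_of_le_of_le' tendsto_const_nhds hlim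
    (.of_forall fun _ => zero_le) ?_
  filter_upwards [eventually_gt_atTop 0] with r hr
  refine iSup₂_le fun κ hκ => ?_
  calc κ {x | r < ‖x‖} ≤ κ {x | ENNReal.ofReal r ≤ ‖x‖ₑ} := measure_mono fun x hx => by
        rw [Set.mem_ofPred_eq, ← ofReal_norm]
        exact ENNReal.ofReal_le_ofReal (le_of_lt hx)
    _ ≤ (∫⁻ x, ‖x‖ₑ ∂κ) / ENNReal.ofReal r := meas_ge_le_lintegral_div (by fun_prop)
        (ENNReal.ofReal_pos.2 hr).ne' ENNReal.ofReal_ne_top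
    _ ≤ C / ENNReal.ofReal r := ENNReal.div_le_div_right hκ _

lemma isCompact_setOf_lintegral_enorm_le (hC : C ≠ ⊤) :
    IsCompact {π : ProbabilityMeasure E | ∫⁻ x, ‖x‖ₑ ∂(π : Measure E) ≤ C} := by
  have hclosed : IsClosed {π : ProbabilityMeasure E | ∫⁻ x, ‖x‖ₑ ∂(π : Measure E) ≤ C} :=
    (lowerSemicontinuous_lintegral continuous_nnnorm).isClosed_preimage C
  rw [← hclosed.closure_eq]
  refine isCompact_closure_of_isTightMeasureSet
    ((isTightMeasureSet_setOf_lintegral_enorm_le hC).subset ?_)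
  rintro _ ⟨π, hπ, rfl⟩
  exact hπ

end FirstMoment

section Duality

lemma abs_le_div_mul_add {η : ℝ} (hη : 0 < η) (a b : ℝ) :
    |a| ≤ b / (|b| + η) * a + 2 * |a - b| + η := by
  have hpos : 0 < |b| + η := by positivity
  have hb : |b| ≤ b / (|b| + η) * b + η := by
    rw [div_mul_eq_mul_div, div_add' _ _ _ hpos.ne', le_div_iff₀ hpos, ← abs_mul_abs_self b]
    nlinarith [abs_nonneg b]
  have hab : b / (|b| + η) * (b - a) ≤ |a - b| := by
    rw [abs_sub_comm]
    refine (le_abs_self _).trans ?_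
    rw [abs_mul, abs_div, abs_of_pos hpos]
    exact mul_le_of_le_one_left (abs_nonneg _) ((div_le_one hpos).2 (by linarith))
  linarith [abs_sub_abs_le_abs_sub a b, mul_sub (b / (|b| + η)) b a]

variable {ι : Type*} [Fintype ι]

lemma abs_dotProduct_le_sum_abs {v : ι → ℝ} (hv : ‖v‖ ≤ 1) (w : ι → ℝ) :
    |v ⬝ᵥ w| ≤ ∑ i, |w i| := by
  refine (Finset.abs_sum_le_sum_abs _ _).trans (Finset.sum_le_sum fun i _ => ?_)
  rw [abs_mul]
  exact mul_le_of_le_one_left (abs_nonneg _) ((norm_le_pi_norm v i).trans hv)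

lemma integrable_dotProduct {Ω : Type*} {_ : MeasurableSpace Ω} {κ : Measure Ω}
    {h f : Ω → ι → ℝ} {C : ℝ} (hh : AEStronglyMeasurable h κ) (hC : ∀ x, ‖h x‖ ≤ C)
    (hf : Integrable f κ) : Integrable (fun x => h x ⬝ᵥ f x) κ :=
  integrable_finsetSum _ fun i _ => (hf.eval i).bdd_mul (c := C)
    ((continuous_apply i).comp_aestronglyMeasurable hh)
    (ae_of_all _ fun x => (norm_le_pi_norm (h x) i).trans (hC x))

lemma exists_sum_abs_le_dotProduct_add {S : Type*} [TopologicalSpace S] (g : S →ᵇ (ι → ℝ)) {η : ℝ}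
    (hη : 0 < η) : ∃ φ : S →ᵇ (ι → ℝ), ‖φ‖ ≤ 1 ∧
      ∀ s w, ∑ i, |w i| ≤ φ s ⬝ᵥ w + Fintype.card ι * (2 * ‖w - g s‖ + η) := by
  -- a continuous substitute for the vector of signs of `g`
  refine ⟨.ofNormedAddCommGroup (fun s i => g s i / (|g s i| + η))
    (continuous_pi fun i => Continuous.div₀ (by fun_prop) (by fun_prop) fun s => by positivity) 1
    fun s => (pi_norm_le_iff_of_nonneg zero_le_one).2 fun i => ?_,
    BoundedContinuousFunction.norm_ofNormedAddCommGroup_le _ zero_le_one _, fun s w => ?_⟩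
  · rw [norm_div, Real.norm_eq_abs, Real.norm_of_nonneg (by positivity),
      div_le_one (by positivity)]
    linarith
  · rw [← nsmul_eq_mul, ← Finset.card_univ, ← Finset.sum_const, dotProduct,
      ← Finset.sum_add_distrib]
    refine Finset.sum_le_sum fun i _ => (abs_le_div_mul_add hη (w i) (g s i)).trans ?_
    rw [add_assoc]
    exact add_le_add_right (by gcongr; exact norm_le_pi_norm (w - g s) i) _

lemma integral_sum_abs_le_iff {S : Type*} [TopologicalSpace S]
    [TopologicalSpace.PseudoMetrizableSpace S] [MeasurableSpace S] [BorelSpace S]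
    {κ : Measure S} [IsFiniteMeasure κ] {y : S → ι → ℝ} (hy : Integrable y κ) {ε : ℝ} :
    ∫ s, ∑ i, |y s i| ∂κ ≤ ε ↔ ∀ φ : S →ᵇ (ι → ℝ), ‖φ‖ ≤ 1 → ∫ s, φ s ⬝ᵥ y s ∂κ ≤ ε := by
  have hyi : Integrable (fun s => ∑ i, |y s i|) κ :=
    integrable_finsetSum _ fun i _ => (hy.eval i).abs
  have hφy : ∀ φ : S →ᵇ (ι → ℝ), Integrable (fun s => φ s ⬝ᵥ y s) κ := fun φ =>
    integrable_dotProduct (StronglyMeasurable.aestronglyMeasurable φ.continuous.stronglyMeasurable)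
      φ.norm_coe_le_norm hy
  refine ⟨fun h φ hφ => (integral_mono (hφy φ) hyi fun s =>
    le_of_abs_le (abs_dotProduct_le_sum_abs ((φ.norm_coe_le_norm s).trans hφ) _)).trans h,
    fun h => le_of_forall_pos_le_add fun δ hδ => ?_⟩
  obtain ⟨η, hη, hηδ⟩ := exists_pos_mul_lt hδ (Fintype.card ι * (2 + κ.real Set.univ))
  obtain ⟨g, hg, hgi⟩ := hy.exists_boundedContinuous_integral_sub_le hη
  obtain ⟨φ, hφ, hgφ⟩ := exists_sum_abs_le_dotProduct_add g hη
  have hyg : Integrable (fun s => 2 * ‖y s - g s‖) κ := (hy.sub hgi).norm.const_mul 2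
  have herr : Integrable (fun s => Fintype.card ι * (2 * ‖y s - g s‖ + η)) κ :=
    (hyg.add (integrable_const η)).const_mul _
  calc ∫ s, ∑ i, |y s i| ∂κ
      ≤ ∫ s, (φ s ⬝ᵥ y s + Fintype.card ι * (2 * ‖y s - g s‖ + η)) ∂κ :=
        integral_mono hyi ((hφy φ).add herr) fun s => hgφ s (y s)
    _ = ∫ s, φ s ⬝ᵥ y s ∂κ +
          Fintype.card ι * (2 * ∫ s, ‖y s - g s‖ ∂κ + κ.real Set.univ * η) := by
        rw [integral_add (hφy φ) herr, integral_const_mul, integral_add hyg (integrable_const η),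
          integral_const_mul, integral_const, smul_eq_mul]
    _ ≤ ε + Fintype.card ι * (2 * η + κ.real Set.univ * η) := by
        gcongr
        exact h φ hφ
    _ ≤ ε + δ := by linarith

variable {Ω : Type*} {m₀ : MeasurableSpace Ω} {κ : Measure Ω} [IsFiniteMeasure κ]

lemma integral_dotProduct_condExp {m : MeasurableSpace Ω} (hm : m ≤ m₀) {f h : Ω → ι → ℝ}
    (hf : Integrable f κ) (hh : StronglyMeasurable[m] h) {C : ℝ} (hC : ∀ x, ‖h x‖ ≤ C) :
    ∫ x, h x ⬝ᵥ (fun i => κ[fun z => f z i | m] x) ∂κ = ∫ x, h x ⬝ᵥ f x ∂κ := by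
  have hhi : ∀ i, StronglyMeasurable[m] fun x => h x i := fun i =>
    (continuous_apply i).comp_stronglyMeasurable hh
  have hCi : ∀ i x, ‖h x i‖ ≤ C := fun i x => (norm_le_pi_norm (h x) i).trans (hC x)
  have hbdd : ∀ i {g : Ω → ℝ}, Integrable g κ → Integrable (fun x => h x i * g x) κ :=
    fun i _ hg => hg.bdd_mul ((hhi i).mono hm).aestronglyMeasurable (ae_of_all _ (hCi i))
  simp only [dotProduct]
  rw [integral_finsetSum _ fun i _ => hbdd i integrable_condExp,
    integral_finsetSum _ fun i _ => hbdd i (hf.eval i)]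
  refine Finset.sum_congr rfl fun i _ => ?_
  exact (integral_congr_ae (condExp_stronglyMeasurable_mul_of_bound hm (hhi i) (hf.eval i) C
    (ae_of_all _ (hCi i)))).symm.trans (integral_condExp hm)

lemma integral_sum_abs_condExp_le_iff {S : Type*} [TopologicalSpace S]
    [TopologicalSpace.PseudoMetrizableSpace S] [MeasurableSpace S] [BorelSpace S] {r : Ω → S}
    (hr : Measurable r) {f : Ω → ι → ℝ} (hf : Integrable f κ) {ε : ℝ} :
    ∫ x, ∑ i, |(κ[fun z => f z i | MeasurableSpace.comap r inferInstance]) x| ∂κ ≤ ε ↔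
      ∀ φ : S →ᵇ (ι → ℝ), ‖φ‖ ≤ 1 → ∫ x, φ (r x) ⬝ᵥ f x ∂κ ≤ ε := by
  choose y hy hyr using fun i =>
    (stronglyMeasurable_condExp (m := MeasurableSpace.comap r inferInstance) (μ := κ)
      (f := fun z => f z i)).measurable.exists_eq_measurable_comp
  have hYi : Integrable (fun s i => y i s) (κ.map r) := Integrable.of_eval fun i => by
    rw [integrable_map_measure (hy i).aestronglyMeasurable hr.aemeasurable, ← hyr i]
    exact integrable_condExp
  have hφ : ∀ φ : S →ᵇ (ι → ℝ), ∫ s, φ s ⬝ᵥ (fun i => y i s) ∂κ.map r = ∫ x, φ (r x) ⬝ᵥ f x ∂κ :=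
    fun φ => by
      rw [← integral_dotProduct_condExp hr.comap_le hf (h := fun x => φ (r x))
        (φ.continuous.measurable.comp (comap_measurable r)).stronglyMeasurable
        (fun x => φ.norm_coe_le_norm (r x)), integral_map hr.aemeasurable
          (Measurable.aestronglyMeasurable (by fun_prop))]
      simp only [hyr, Function.comp_apply]
  simp only [← hφ, ← integral_sum_abs_le_iff hYi, hyr, Function.comp_apply]
  rw [integral_map hr.aemeasurable (Measurable.aestronglyMeasurable (by fun_prop))]

end Duality

section LinearGrowth

variable {E : Type*} [NormedAddCommGroup E] {c : E → ℝ} {L : ℝ≥0}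

lemma abs_le_of_lipschitzWith (hc : LipschitzWith L c) (x : E) : |c x| ≤ |c 0| + L * ‖x‖ := by
  have h := hc.dist_le_mul x 0
  rw [Real.dist_eq, dist_zero_right] at h
  linarith [abs_sub_abs_le_abs_sub (c x) (c 0)]

variable {Ω : Type*} {m : MeasurableSpace Ω} {κ : Measure Ω} [IsFiniteMeasure κ] {X Y : Ω → E}

lemma integrable_comp_of_linearGrowth (hc : Continuous c) {A B : ℝ}
    (hAB : ∀ x, |c x| ≤ A + B * ‖x‖) (hX : Integrable X κ) : Integrable (fun ω => c (X ω)) κ :=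
  ((integrable_const A).add (hX.norm.const_mul B)).mono'
    (hc.comp_aestronglyMeasurable hX.aestronglyMeasurable) (ae_of_all _ fun ω => hAB (X ω))

lemma abs_integral_comp_sub_le (hc : LipschitzWith L c) (hX : Integrable X κ)
    (hY : Integrable Y κ) :
    |∫ ω, c (X ω) ∂κ - ∫ ω, c (Y ω) ∂κ| ≤ L * ∫ ω, ‖X ω - Y ω‖ ∂κ := by
  have hcX := integrable_comp_of_linearGrowth hc.continuous (abs_le_of_lipschitzWith hc) hX
  have hcY := integrable_comp_of_linearGrowth hc.continuous (abs_le_of_lipschitzWith hc) hY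
  rw [← integral_sub hcX hcY, ← integral_const_mul]
  exact abs_integral_le_integral_abs.trans (integral_mono (hcX.sub hcY).abs
    ((hX.sub hY).norm.const_mul _) fun ω => hc.norm_sub_le (X ω) (Y ω))

end LinearGrowth

section Wasserstein

variable {μ ν : ProbabilityMeasure ℝ} {γ : ProbabilityMeasure (ℝ × ℝ)}

lemma integrable_fst_of_mem_couplings (hγ : γ ∈ couplings μ ν)
    (hμ : Integrable (fun y : ℝ => y) μ) :
    Integrable (fun p : ℝ × ℝ => p.1) (γ : Measure (ℝ × ℝ)) := by
  rw [← hγ.1] at hμ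
  exact hμ.comp_measurable measurable_fst

lemma integrable_snd_of_mem_couplings (hγ : γ ∈ couplings μ ν)
    (hν : Integrable (fun y : ℝ => y) ν) :
    Integrable (fun p : ℝ × ℝ => p.2) (γ : Measure (ℝ × ℝ)) := by
  rw [← hγ.2] at hν
  exact hν.comp_measurable measurable_snd

lemma isClosed_couplings (μ ν : ProbabilityMeasure ℝ) : IsClosed (couplings μ ν) :=
  (isClosed_setOf_map_eq continuous_fst μ).inter (isClosed_setOf_map_eq continuous_snd ν)

lemma isCompact_couplings (hμ : Integrable (fun y : ℝ => y) μ)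
    (hν : Integrable (fun y : ℝ => y) ν) : IsCompact (couplings μ ν) := by
  have hC : ∫⁻ y, ‖y‖ₑ ∂(μ : Measure ℝ) + ∫⁻ y, ‖y‖ₑ ∂(ν : Measure ℝ) ≠ ⊤ :=
    ENNReal.add_ne_top.2 ⟨hμ.2.ne, hν.2.ne⟩
  refine (isCompact_setOf_lintegral_enorm_le hC).of_isClosed_subset (isClosed_couplings μ ν)
    fun γ hγ => ?_
  rw [Set.mem_ofPred_eq, ← hγ.1, ← hγ.2, lintegral_map (by fun_prop) measurable_fst,
    lintegral_map (by fun_prop) measurable_snd, ← lintegral_add_left (by fun_prop)]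
  refine lintegral_mono fun p => ?_
  simp only [enorm_eq_nnnorm, Prod.nnnorm_def]
  exact_mod_cast max_le le_self_add le_add_self

lemma exists_optimal_coupling (hμ : Integrable (fun y : ℝ => y) μ)
    (hν : Integrable (fun y : ℝ => y) ν) :
    ∃ γ ∈ couplings μ ν,
      ∫ p, |p.1 - p.2| ∂(γ : Measure (ℝ × ℝ)) = (wasserstein μ ν).toReal := by
  have hlsc : LowerSemicontinuous fun γ : ProbabilityMeasure (ℝ × ℝ) =>
      ∫⁻ p, ENNReal.ofReal |p.1 - p.2| ∂(γ : Measure (ℝ × ℝ)) :=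
    lowerSemicontinuous_lintegral (by fun_prop)
  obtain ⟨γ, hγ, hmin⟩ := (hlsc.lowerSemicontinuousOn _).exists_isMinOn
    ⟨μ.prod ν, by simp [couplings]⟩ (isCompact_couplings hμ hν)
  have hW : wasserstein μ ν = ∫⁻ p, ENNReal.ofReal |p.1 - p.2| ∂(γ : Measure (ℝ × ℝ)) :=
    le_antisymm (iInf₂_le γ hγ) (le_iInf₂ hmin)
  refine ⟨γ, hγ, ?_⟩
  rw [hW, integral_eq_lintegral_of_nonneg_ae (ae_of_all _ fun p => abs_nonneg _)
    (Measurable.aestronglyMeasurable (by fun_prop))]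

lemma abs_integral_sub_le_wasserstein (hμ : Integrable (fun y : ℝ => y) μ)
    (hν : Integrable (fun y : ℝ => y) ν) {f : ℝ → ℝ} {L : ℝ≥0} (hf : LipschitzWith L f) :
    |∫ y, f y ∂(μ : Measure ℝ) - ∫ y, f y ∂(ν : Measure ℝ)| ≤ L * (wasserstein μ ν).toReal := by
  obtain ⟨γ, hγ, hW⟩ := exists_optimal_coupling hμ hν
  rw [← hW, ← hγ.1, ← hγ.2,
    integral_map (by fun_prop) hf.continuous.aestronglyMeasurable,
    integral_map (by fun_prop) hf.continuous.aestronglyMeasurable]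
  exact abs_integral_comp_sub_le hf (integrable_fst_of_mem_couplings hγ hμ)
    (integrable_snd_of_mem_couplings hγ hν)

lemma wasserstein_self (μ : ProbabilityMeasure ℝ) : wasserstein μ μ = 0 := by
  have hdiag : Measurable fun y : ℝ => (y, y) := by fun_prop
  have hmem : μ.map hdiag.aemeasurable ∈ couplings μ μ :=
    ⟨(Measure.map_map measurable_fst hdiag).trans Measure.map_id,
      (Measure.map_map measurable_snd hdiag).trans Measure.map_id⟩
  refine le_antisymm ((iInf₂_le _ hmem).trans_eq ?_) zero_le
  rw [ProbabilityMeasure.toMeasure_map, lintegral_map (by fun_prop) hdiag]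
  simp

variable {T d : ℕ}

lemma discrepancy_self (μ : Marginals T d) : discrepancy μ μ = 0 := by
  simp [discrepancy, wasserstein_self]

lemma two_mul_sum_wasserstein_le_discrepancy (ν μ : Marginals T d) (t : Fin T) :
    2 * ∑ i, (wasserstein (ν t i) (μ t i)).toReal ≤ discrepancy ν μ :=
  mul_le_mul_of_nonneg_left
    (le_ciSup (f := fun t => ∑ i, (wasserstein (ν t i) (μ t i)).toReal)
      (Set.finite_range _).bddAbove t) zero_le_two

variable {ι : Type*} {F : Filter ι} {ν : ι → Marginals T d} {μ : Marginals T d}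

lemma tendsto_wasserstein_of_discrepancy (hr : Tendsto (fun n => discrepancy (ν n) μ) F (𝓝 0))
    (t : Fin T) (i : Fin d) :
    Tendsto (fun n => (wasserstein (ν n t i) (μ t i)).toReal) F (𝓝 0) := by
  refine squeeze_zero (fun n => ENNReal.toReal_nonneg) (fun n => ?_) hr
  have hsum := two_mul_sum_wasserstein_le_discrepancy (ν n) μ t
  have hterm := Finset.single_le_sum (f := fun i => (wasserstein (ν n t i) (μ t i)).toReal)
    (fun _ _ => ENNReal.toReal_nonneg) (Finset.mem_univ i)
  have hnonneg : 0 ≤ (wasserstein (ν n t i) (μ t i)).toReal := ENNReal.toReal_nonneg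
  linarith

lemma tendsto_marginal_of_discrepancy (hν : ∀ n, (ν n).FiniteFirstMoments)
    (hμ : μ.FiniteFirstMoments) (hr : Tendsto (fun n => discrepancy (ν n) μ) F (𝓝 0))
    (t : Fin T) (i : Fin d) : Tendsto (fun n => ν n t i) F (𝓝 (μ t i)) :=
  tendsto_of_abs_integral_sub_le (tendsto_wasserstein_of_discrepancy hr t i)
    fun n _ _ hf => abs_integral_sub_le_wasserstein (hν n t i) (hμ t i) hf

lemma tendsto_integral_abs_of_discrepancy (hν : ∀ n, (ν n).FiniteFirstMoments)
    (hμ : μ.FiniteFirstMoments) (hr : Tendsto (fun n => discrepancy (ν n) μ) F (𝓝 0))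
    (t : Fin T) (i : Fin d) :
    Tendsto (fun n => ∫ y, |y| ∂(ν n t i : Measure ℝ)) F (𝓝 (∫ y, |y| ∂(μ t i : Measure ℝ))) :=
  tendsto_iff_norm_sub_tendsto_zero.2 (squeeze_zero (fun _ => norm_nonneg _) (fun n =>
    (abs_integral_sub_le_wasserstein (hν n t i) (hμ t i) lipschitzWith_one_norm).trans_eq
      (one_mul _)) (tendsto_wasserstein_of_discrepancy hr t i))

end Wasserstein

section Plans

variable {T d : ℕ} {μ : Marginals T d} {π : ProbabilityMeasure (PathSpace T d)}

lemma norm_le_sum_abs (x : PathSpace T d) : ‖x‖ ≤ ∑ t, ∑ i, |x t i| :=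
  (pi_norm_le_iff_of_nonneg (by positivity)).2 fun t =>
    (pi_norm_le_iff_of_nonneg (by positivity)).2 fun i =>
      (Finset.single_le_sum (f := fun j => |x t j|) (fun _ _ => abs_nonneg _)
        (Finset.mem_univ i)).trans (Finset.single_le_sum (f := fun u => ∑ j, |x u j|)
          (fun _ _ => by positivity) (Finset.mem_univ t))

lemma measurable_coord (t : Fin T) (i : Fin d) : Measurable fun x : PathSpace T d => x t i := by
  fun_prop

lemma integrable_coord (hπ : π ∈ transportPlans μ) (t : Fin T) (i : Fin d) :
    Integrable (fun x => x t i) (π : Measure (PathSpace T d)) :=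
  (hπ.1.eval t).eval i

lemma integrable_increment (hπ : π ∈ transportPlans μ) (s t : Fin T) :
    Integrable (fun x => x t - x s) (π : Measure (PathSpace T d)) :=
  (hπ.1.eval t).sub (hπ.1.eval s)

lemma finiteFirstMoments_of_mem_transportPlans (hπ : π ∈ transportPlans μ) :
    μ.FiniteFirstMoments := fun t i => by
  rw [← hπ.2 t i, integrable_map_measure (by fun_prop) (measurable_coord t i).aemeasurable]
  exact integrable_coord hπ t i

lemma mem_transportPlans_iff (hμ : μ.FiniteFirstMoments) : π ∈ transportPlans μ ↔
    ∀ t i, (π : Measure (PathSpace T d)).map (fun x => x t i) = μ t i := by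
  refine ⟨fun hπ => hπ.2, fun hπ => ⟨.of_eval fun t => .of_eval fun i => ?_, hπ⟩⟩
  have h := hμ t i
  rw [← hπ t i] at h
  exact h.comp_measurable (measurable_coord t i)

/-- The expected `ℓ¹`-distance between `E_π[X_t | X_1, …, X_s]` and `X_s`, so that
`relaxedPlans ε μ` consists of the transport plans whose one-step defects are at most `ε`. -/
noncomputable def martingaleDefect (π : ProbabilityMeasure (PathSpace T d)) (s t : Fin T) : ℝ :=
  ∫ x, ∑ i, |condMean π s t i x - x s i| ∂(π : Measure (PathSpace T d))

lemma measurable_comp_restrictLe {E : Type*} [MeasurableSpace E] {s : Fin T}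
    {h : (Set.Iic s → Fin d → ℝ) → E} (hh : Measurable h) :
    Measurable[Filtration.piLE (X := fun _ : Fin T => Fin d → ℝ) s]
      fun x : PathSpace T d => h (Preorder.restrictLe s x) :=
  hh.comp (comap_measurable _)

lemma condMean_sub_ae_eq (hπ : π ∈ transportPlans μ) (s t : Fin T) (i : Fin d) :
    (fun x => condMean π s t i x - x s i) =ᵐ[(π : Measure (PathSpace T d))]
      (π : Measure (PathSpace T d))[fun x => (x t - x s) i |
        Filtration.piLE (X := fun _ : Fin T => Fin d → ℝ) s] := by
  have h := condExp_sub (integrable_coord hπ t i) (integrable_coord hπ s i)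
    (Filtration.piLE (X := fun _ : Fin T => Fin d → ℝ) s)
  have hs : StronglyMeasurable[Filtration.piLE (X := fun _ : Fin T => Fin d → ℝ) s]
      fun x : PathSpace T d => x s i :=
    (measurable_comp_restrictLe (h := fun y => y ⟨s, Set.self_mem_Iic⟩ i)
      (by fun_prop)).stronglyMeasurable
  rw [condExp_of_stronglyMeasurable (Filtration.le _ s) hs (integrable_coord hπ s i)] at h
  exact h.symm

lemma martingaleDefect_le_iff (hπ : π ∈ transportPlans μ) (s t : Fin T) {ε : ℝ} :
    martingaleDefect π s t ≤ ε ↔ ∀ φ : (Set.Iic s → Fin d → ℝ) →ᵇ (Fin d → ℝ), ‖φ‖ ≤ 1 →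
      ∫ x, φ (Preorder.restrictLe s x) ⬝ᵥ (x t - x s) ∂(π : Measure (PathSpace T d)) ≤ ε := by
  rw [← integral_sum_abs_condExp_le_iff (Preorder.measurable_restrictLe s)
    (integrable_increment hπ s t), martingaleDefect]
  have h : ∫ x, ∑ i, |condMean π s t i x - x s i| ∂(π : Measure (PathSpace T d)) =
      ∫ x, ∑ i, |(π : Measure (PathSpace T d))[fun x => (x t - x s) i |
        Filtration.piLE (X := fun _ : Fin T => Fin d → ℝ) s] x| ∂(π : Measure (PathSpace T d)) := by
    refine integral_congr_ae ?_
    filter_upwards [ae_all_iff.2 (condMean_sub_ae_eq hπ s t)] with x hx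
    simp only [hx]
  rw [h]
  rfl

lemma relaxedPlans_mono {ε ε' : ℝ} (h : ε ≤ ε') : relaxedPlans ε μ ⊆ relaxedPlans ε' μ :=
  fun _ hπ => ⟨hπ.1, fun s t hst => (hπ.2 s t hst).trans h⟩

lemma martingaleDefect_le_zero_iff (hπ : π ∈ transportPlans μ) (s t : Fin T) :
    martingaleDefect π s t ≤ 0 ↔
      ∀ i, condMean π s t i =ᵐ[(π : Measure (PathSpace T d))] fun x => x s i := by
  have hi : Integrable (fun x => ∑ i, |condMean π s t i x - x s i|)
      (π : Measure (PathSpace T d)) := integrable_finsetSum _ fun i _ =>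
    (integrable_condExp.sub (integrable_coord hπ s i)).abs
  have h0 : ∀ x, 0 ≤ ∑ i, |condMean π s t i x - x s i| := fun x => by positivity
  have hz : martingaleDefect π s t ≤ 0 ↔ martingaleDefect π s t = 0 :=
    ⟨fun h => h.antisymm (integral_nonneg h0), le_of_eq⟩
  rw [hz, martingaleDefect, integral_eq_zero_iff_of_nonneg h0 hi]
  simp only [EventuallyEq]
  rw [← eventually_countable_forall]
  refine eventually_congr (.of_forall fun x => ?_)
  simp [Finset.sum_eq_zero_iff_of_nonneg, sub_eq_zero]

lemma martingalePlans_eq_relaxedPlans_zero : martingalePlans μ = relaxedPlans 0 μ :=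
  Set.ext fun _ => and_congr_right fun hπ => forall_congr' fun s => forall_congr' fun t =>
    imp_congr_right fun _ => (martingaleDefect_le_zero_iff hπ s t).symm

lemma integral_dotProduct_increment_eq_zero (hπ : π ∈ martingalePlans μ) {s t : Fin T}
    (hst : (s : ℕ) + 1 = (t : ℕ)) {h : (Set.Iic s → Fin d → ℝ) → Fin d → ℝ} (hh : Measurable h)
    {C : ℝ} (hC : ∀ y, ‖h y‖ ≤ C) :
    ∫ x, h (Preorder.restrictLe s x) ⬝ᵥ (x t - x s) ∂(π : Measure (PathSpace T d)) = 0 := by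
  rw [← integral_dotProduct_condExp (Filtration.le _ s) (integrable_increment hπ.1 s t)
    (measurable_comp_restrictLe hh).stronglyMeasurable fun x => hC _]
  refine integral_eq_zero_of_ae ?_
  filter_upwards [ae_all_iff.2 (condMean_sub_ae_eq hπ.1 s t), ae_all_iff.2 (hπ.2 s t hst)]
    with x h1 h2
  exact Finset.sum_eq_zero fun i _ =>
    mul_eq_zero_of_right _ ((h1 i).symm.trans (sub_eq_zero.2 (h2 i)))

end Plans

section Perturbation

lemma exists_measurable_map_prod_unitInterval {X Y : Type*} [MeasurableSpace X]
    [MeasurableSpace Y] [StandardBorelSpace Y] [Nonempty Y] (η : Measure (X × Y))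
    [IsFiniteMeasure η] : ∃ f : X → unitInterval → Y, Measurable (Function.uncurry f) ∧
      (η.fst.prod (volume : Measure unitInterval)).map (fun p => (p.1, f p.1 p.2)) = η := by
  obtain ⟨f, hf, hfκ⟩ := η.condKernel.exists_measurable_map_eq_unitInterval
  have hf' : Measurable fun p : X × unitInterval => f p.1 p.2 := hf
  have hg : Measurable fun p : X × unitInterval => (p.1, f p.1 p.2) := measurable_fst.prodMk hf'
  refine ⟨f, hf, ?_⟩
  conv_rhs => rw [← η.disintegrate η.condKernel]
  ext s hs
  rw [Measure.map_apply hg hs, Measure.prod_apply (hg hs), Measure.compProd_apply hs]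
  refine lintegral_congr fun a => ?_
  have hfa : Measurable (f a) := hf'.comp measurable_prodMk_left
  rw [← hfκ a, Measure.map_apply hfa (measurable_prodMk_left hs)]
  rfl

lemma exists_map_eq_of_mem_couplings {ν μ : ProbabilityMeasure ℝ}
    {γ : ProbabilityMeasure (ℝ × ℝ)} (hγ : γ ∈ couplings ν μ) :
    ∃ f : ℝ → unitInterval → ℝ, Measurable (Function.uncurry f) ∧
      ((μ : Measure ℝ).prod (volume : Measure unitInterval)).map
        (fun p => (f p.1 p.2, p.1)) = γ := by
  obtain ⟨f, hf, hmap⟩ :=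
    exists_measurable_map_prod_unitInterval ((γ : Measure (ℝ × ℝ)).map Prod.swap)
  have hf' : Measurable fun p : ℝ × unitInterval => f p.1 p.2 := hf
  rw [Measure.fst_map_swap, Measure.snd, hγ.2] at hmap
  refine ⟨f, hf, ?_⟩
  have h := congrArg (Measure.map Prod.swap) hmap
  rwa [Measure.map_map measurable_swap (measurable_fst.prodMk hf'),
    Measure.map_map measurable_swap measurable_swap, Prod.swap_swap_eq, Measure.map_id] at h

variable {T d : ℕ} {μ ν : Marginals T d} {π : ProbabilityMeasure (PathSpace T d)}

lemma martingaleDefect_map_le {Ω : Type*} [MeasurableSpace Ω] {Q : Measure Ω}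
    {X Y : Ω → PathSpace T d} (hX : Integrable X Q) (hY : Measurable Y)
    (hπ : π ∈ transportPlans μ) (hYπ : Q.map Y = π) {s t : Fin T}
    (horth : ∀ φ : (Set.Iic s → Fin d → ℝ) →ᵇ (Fin d → ℝ),
      ∫ ω, φ (Preorder.restrictLe s (Y ω)) ⬝ᵥ (X ω t - X ω s) ∂Q = 0) :
    martingaleDefect π s t ≤
      ∑ i, ∫ ω, |Y ω t i - X ω t i| ∂Q + ∑ i, ∫ ω, |Y ω s i - X ω s i| ∂Q := by
  have hYi : Integrable Y Q := by
    have h := hπ.1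
    rw [← hYπ] at h
    exact h.comp_measurable hY
  have hD (u : Fin T) : Integrable (fun ω => Y ω u - X ω u) Q := (hYi.eval u).sub (hX.eval u)
  have hDabs (u : Fin T) : Integrable (fun ω => ∑ i, |Y ω u i - X ω u i|) Q :=
    integrable_finsetSum _ fun i _ => ((hD u).eval i).abs
  have hsum (u : Fin T) :
      ∫ ω, ∑ i, |Y ω u i - X ω u i| ∂Q = ∑ i, ∫ ω, |Y ω u i - X ω u i| ∂Q :=
    integral_finsetSum _ fun i _ => ((hD u).eval i).abs
  refine (martingaleDefect_le_iff hπ s t).2 fun φ hφ => ?_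
  have hdot {f : Ω → Fin d → ℝ} (hf : Integrable f Q) :
      Integrable (fun ω => φ (Preorder.restrictLe s (Y ω)) ⬝ᵥ f ω) Q :=
    integrable_dotProduct (φ.continuous.measurable.comp
      ((Preorder.measurable_restrictLe s).comp hY)).aestronglyMeasurable
      (fun ω => φ.norm_coe_le_norm _) hf
  have hincr {Z : Ω → PathSpace T d} (hZ : Integrable Z Q) :
      Integrable (fun ω => Z ω t - Z ω s) Q := (hZ.eval t).sub (hZ.eval s)
  have hDts : Integrable (fun ω => (Y ω t - X ω t) - (Y ω s - X ω s)) Q := (hD t).sub (hD s)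
  calc ∫ x, φ (Preorder.restrictLe s x) ⬝ᵥ (x t - x s) ∂(π : Measure (PathSpace T d))
      = ∫ ω, φ (Preorder.restrictLe s (Y ω)) ⬝ᵥ (Y ω t - Y ω s) ∂Q := by
        rw [← hYπ, integral_map hY.aemeasurable (by fun_prop)]
    _ = ∫ ω, φ (Preorder.restrictLe s (Y ω)) ⬝ᵥ ((Y ω t - X ω t) - (Y ω s - X ω s)) ∂Q := by
        rw [← sub_eq_zero, ← integral_sub (hdot (hincr hYi)) (hdot hDts), ← horth φ]
        refine integral_congr_ae (ae_of_all _ fun ω => ?_)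
        simp only [← dotProduct_sub]
        congr 1
        abel
    _ ≤ ∫ ω, (∑ i, |Y ω t i - X ω t i| + ∑ i, |Y ω s i - X ω s i|) ∂Q := by
        refine integral_mono (hdot hDts) ((hDabs t).add (hDabs s)) fun ω => ?_
        have hφω : ‖φ (Preorder.restrictLe s (Y ω))‖ ≤ 1 := (φ.norm_coe_le_norm _).trans hφ
        refine (le_of_abs_le (abs_dotProduct_le_sum_abs hφω _)).trans ?_
        rw [← Finset.sum_add_distrib]
        exact Finset.sum_le_sum fun i _ => abs_sub _ _
    _ = ∑ i, ∫ ω, |Y ω t i - X ω t i| ∂Q + ∑ i, ∫ ω, |Y ω s i - X ω s i| ∂Q := by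
        rw [integral_add (hDabs t) (hDabs s), hsum, hsum]

lemma integral_dotProduct_randomized_eq_zero (hπ : π ∈ martingalePlans μ) {s t : Fin T}
    (hst : (s : ℕ) + 1 = (t : ℕ)) {f : Fin T → Fin d → ℝ → unitInterval → ℝ}
    (hf : ∀ t i, Measurable (Function.uncurry (f t i)))
    (φ : (Set.Iic s → Fin d → ℝ) →ᵇ (Fin d → ℝ)) :
    ∫ p, φ (Preorder.restrictLe s fun t i => f t i (p.1 t i) p.2) ⬝ᵥ (p.1 t - p.1 s)
      ∂((π : Measure (PathSpace T d)).prod volume) = 0 := by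
  have hh : Measurable fun p : (Set.Iic s → Fin d → ℝ) × unitInterval =>
      φ fun r j => f r j (p.1 r j) p.2 :=
    φ.continuous.measurable.comp (measurable_pi_lambda _ fun r => measurable_pi_lambda _ fun j =>
      (hf r j).comp (by fun_prop : Measurable fun p : (Set.Iic s → Fin d → ℝ) × unitInterval =>
        (p.1 r j, p.2)))
  have hr : Measurable fun p : PathSpace T d × unitInterval => (Preorder.restrictLe s p.1, p.2) :=
    ((Preorder.measurable_restrictLe s).comp measurable_fst).prodMk measurable_snd
  have hint : Integrable (fun p : PathSpace T d × unitInterval =>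
      φ (Preorder.restrictLe s fun t i => f t i (p.1 t i) p.2) ⬝ᵥ (p.1 t - p.1 s))
      ((π : Measure (PathSpace T d)).prod volume) :=
    integrable_dotProduct (hh.comp hr).aestronglyMeasurable
      (fun p => φ.norm_coe_le_norm _) ((integrable_increment hπ.1 s t).comp_fst _)
  rw [integral_prod_symm _ hint]
  exact integral_eq_zero_of_ae (ae_of_all _ fun u => integral_dotProduct_increment_eq_zero hπ hst
    (h := fun y => φ fun r j => f r j (y r j) u) (hh.comp measurable_prodMk_right)
    fun y => φ.norm_coe_le_norm _)

lemma exists_map_prod_eq_of_mem_couplings (hπ : π ∈ transportPlans μ)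
    {γ : Fin T → Fin d → ProbabilityMeasure (ℝ × ℝ)}
    (hγ : ∀ t i, γ t i ∈ couplings (ν t i) (μ t i)) :
    ∃ f : Fin T → Fin d → ℝ → unitInterval → ℝ, ∀ t i, Measurable (Function.uncurry (f t i)) ∧
      ((π : Measure (PathSpace T d)).prod (volume : Measure unitInterval)).map
        (fun p => (f t i (p.1 t i) p.2, p.1 t i)) = γ t i := by
  choose f hf hfγ using fun t i => exists_map_eq_of_mem_couplings (hγ t i)
  refine ⟨f, fun t i => ⟨hf t i, ?_⟩⟩
  have hf' : Measurable fun p : ℝ × unitInterval => (f t i p.1 p.2, p.1) :=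
    (hf t i).prodMk measurable_fst
  rw [← hfγ t i, ← hπ.2 t i, ← Measure.map_id (μ := (volume : Measure unitInterval)),
    Measure.map_prod_map _ _ (measurable_coord t i) measurable_id, Measure.map_id,
    Measure.map_map hf' ((measurable_coord t i).prodMap measurable_id)]
  rfl

lemma abs_integral_comp_sub_le_sum {Ω : Type*} [MeasurableSpace Ω] {Q : Measure Ω}
    [IsFiniteMeasure Q] {X Y : Ω → PathSpace T d} (hX : Integrable X Q) (hY : Integrable Y Q)
    {c : PathSpace T d → ℝ} {L : ℝ≥0} (hc : LipschitzWith L c) :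
    |∫ ω, c (Y ω) ∂Q - ∫ ω, c (X ω) ∂Q| ≤ L * ∑ t, ∑ i, ∫ ω, |Y ω t i - X ω t i| ∂Q := by
  have hD (t : Fin T) (i : Fin d) : Integrable (fun ω => |Y ω t i - X ω t i|) Q :=
    (((hY.sub hX).eval t).eval i).abs
  have hDt (t : Fin T) : Integrable (fun ω => ∑ i, |Y ω t i - X ω t i|) Q :=
    integrable_finsetSum _ fun i _ => hD t i
  refine (abs_integral_comp_sub_le hc hY hX).trans (mul_le_mul_of_nonneg_left ?_ L.coe_nonneg)
  refine (integral_mono (hY.sub hX).norm (integrable_finsetSum _ fun t _ => hDt t)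
    fun ω => norm_le_sum_abs _).trans_eq ?_
  rw [integral_finsetSum _ fun t _ => hDt t]
  exact Finset.sum_congr rfl fun t _ => integral_finsetSum _ fun i _ => hD t i

lemma exists_optimal_randomized_map (hπ : π ∈ transportPlans μ) (hν : ν.FiniteFirstMoments) :
    ∃ f : Fin T → Fin d → ℝ → unitInterval → ℝ,
      (∀ t i, Measurable (Function.uncurry (f t i))) ∧
      (∀ t i, ((π : Measure (PathSpace T d)).prod volume).map
        (fun p => f t i (p.1 t i) p.2) = ν t i) ∧
      ∀ t i, ∫ p, |f t i (p.1 t i) p.2 - p.1 t i| ∂((π : Measure (PathSpace T d)).prod volume) =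
        (wasserstein (ν t i) (μ t i)).toReal := by
  choose γ hγ hW using fun t i =>
    exists_optimal_coupling (hν t i) (finiteFirstMoments_of_mem_transportPlans hπ t i)
  obtain ⟨f, hf⟩ := exists_map_prod_eq_of_mem_couplings hπ hγ
  have hpair (t : Fin T) (i : Fin d) : Measurable fun p : PathSpace T d × unitInterval =>
      (f t i (p.1 t i) p.2, p.1 t i) := by
    have hX : Measurable fun p : PathSpace T d × unitInterval => p.1 t i :=
      (measurable_coord t i).comp measurable_fst
    exact ((hf t i).1.comp (hX.prodMk measurable_snd)).prodMk hX
  refine ⟨f, fun t i => (hf t i).1, fun t i => ?_, fun t i => ?_⟩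
  · rw [← (hγ t i).1, ← (hf t i).2, Measure.map_map measurable_fst (hpair t i)]
    rfl
  · rw [← hW t i, ← (hf t i).2, integral_map (hpair t i).aemeasurable (by fun_prop)]

lemma exists_relaxedPlan (hπ : π ∈ martingalePlans μ) (hν : ν.FiniteFirstMoments) :
    ∃ π' ∈ relaxedPlans (discrepancy ν μ) ν,
      ∀ (c : PathSpace T d → ℝ) (L : ℝ≥0), LipschitzWith L c →
        |∫ x, c x ∂(π' : Measure (PathSpace T d)) - ∫ x, c x ∂(π : Measure (PathSpace T d))| ≤
          L * ∑ t, ∑ i, (wasserstein (ν t i) (μ t i)).toReal := by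
  obtain ⟨f, hf, hfν, hcost⟩ := exists_optimal_randomized_map hπ.1 hν
  set Q : Measure (PathSpace T d × unitInterval) :=
    (π : Measure (PathSpace T d)).prod volume with hQ
  set Y : PathSpace T d × unitInterval → PathSpace T d := fun p t i => f t i (p.1 t i) p.2
  have hYm : Measurable Y := measurable_pi_lambda _ fun t => measurable_pi_lambda _ fun i =>
    (hf t i).comp (((measurable_coord t i).comp measurable_fst).prodMk measurable_snd)
  let π' : ProbabilityMeasure (PathSpace T d) :=
    ⟨Q.map Y, Measure.isProbabilityMeasure_map hYm.aemeasurable⟩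
  have hplan : π' ∈ transportPlans ν := (mem_transportPlans_iff hν).2 fun t i =>
    (Measure.map_map (measurable_coord t i) hYm).trans (hfν t i)
  have hX : Integrable (fun p => p.1) Q := hπ.1.1.comp_fst _
  have hY : Integrable Y Q := hplan.1.comp_measurable hYm
  refine ⟨π', ⟨hplan, fun s t hst => ?_⟩, fun c L hc => ?_⟩
  · have hdefect := martingaleDefect_map_le hX hYm hplan rfl
      (integral_dotProduct_randomized_eq_zero hπ hst hf)
    simp only [Y, hcost] at hdefect
    have ht := two_mul_sum_wasserstein_le_discrepancy ν μ t
    have hs := two_mul_sum_wasserstein_le_discrepancy ν μ s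
    exact hdefect.trans (by linarith)
  · have hcY : ∫ x, c x ∂(π' : Measure (PathSpace T d)) = ∫ p, c (Y p) ∂Q :=
      integral_map hYm.aemeasurable hc.continuous.aestronglyMeasurable
    have hcX : ∫ x, c x ∂(π : Measure (PathSpace T d)) = ∫ p, c p.1 ∂Q := by
      rw [hQ, integral_fun_fst c, probReal_univ, one_smul]
    have hbound := abs_integral_comp_sub_le_sum hX hY hc
    simp only [Y, hcost] at hbound
    rwa [hcY, hcX]

lemma nonempty_relaxedPlans (hM : (martingalePlans μ).Nonempty) (hν : ν.FiniteFirstMoments) {ε : ℝ}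
    (hε : discrepancy ν μ ≤ ε) : (relaxedPlans ε ν).Nonempty :=
  hM.elim fun _ hπ => (exists_relaxedPlan hπ hν).imp fun _ h => relaxedPlans_mono hε h.1

lemma exists_tendsto_relaxedPlans {ι : Type*} {F : Filter ι} {ν : ι → Marginals T d}
    (hπ : π ∈ martingalePlans μ) (hν : ∀ n, (ν n).FiniteFirstMoments)
    (hr : Tendsto (fun n => discrepancy (ν n) μ) F (𝓝 0)) :
    ∃ η : ι → ProbabilityMeasure (PathSpace T d),
      (∀ n, η n ∈ relaxedPlans (discrepancy (ν n) μ) (ν n)) ∧ Tendsto η F (𝓝 π) := by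
  choose η hη hc using fun n => exists_relaxedPlan hπ (hν n)
  have hW : Tendsto (fun n => ∑ t, ∑ i, (wasserstein (ν n t i) (μ t i)).toReal) F (𝓝 0) := by
    simpa only [Finset.sum_const_zero] using tendsto_finsetSum Finset.univ fun t _ =>
      tendsto_finsetSum Finset.univ fun i _ => tendsto_wasserstein_of_discrepancy hr t i
  exact ⟨η, hη, tendsto_of_abs_integral_sub_le hW hc⟩

end Perturbation

section Limits

variable {T d : ℕ} {μ : Marginals T d} {ρ : ProbabilityMeasure (PathSpace T d)}

lemma integrable_sum_abs_coord (hρ : ρ ∈ transportPlans μ) :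
    Integrable (fun x => ∑ t, ∑ i, |x t i|) (ρ : Measure (PathSpace T d)) :=
  integrable_finsetSum _ fun t _ => integrable_finsetSum _ fun i _ => (integrable_coord hρ t i).abs

lemma integral_sum_abs_coord (hρ : ρ ∈ transportPlans μ) :
    ∫ x, ∑ t, ∑ i, |x t i| ∂(ρ : Measure (PathSpace T d)) =
      ∑ t, ∑ i, ∫ y, |y| ∂(μ t i : Measure ℝ) := by
  rw [integral_finsetSum _ fun t _ =>
    integrable_finsetSum _ fun i _ => (integrable_coord hρ t i).abs]
  refine Finset.sum_congr rfl fun t _ => ?_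
  rw [integral_finsetSum _ fun i _ => (integrable_coord hρ t i).abs]
  refine Finset.sum_congr rfl fun i _ => ?_
  rw [← hρ.2 t i, integral_map (measurable_coord t i).aemeasurable (by fun_prop)]

lemma lintegral_enorm_le_of_mem_transportPlans (hρ : ρ ∈ transportPlans μ) :
    ∫⁻ x, ‖x‖ₑ ∂(ρ : Measure (PathSpace T d)) ≤
      ENNReal.ofReal (∑ t, ∑ i, ∫ y, |y| ∂(μ t i : Measure ℝ)) := by
  rw [← integral_sum_abs_coord hρ, ← ofReal_integral_norm_eq_lintegral_enorm hρ.1]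
  exact ENNReal.ofReal_le_ofReal
    (integral_mono hρ.1.norm (integrable_sum_abs_coord hρ) norm_le_sum_abs)

variable {ι : Type*} {F : Filter ι} {ν : ι → Marginals T d}
  {π : ι → ProbabilityMeasure (PathSpace T d)} {ε : ι → ℝ} {ε₀ : ℝ}

lemma tendsto_sum_integral_abs (hν : ∀ n, (ν n).FiniteFirstMoments) (hμ : μ.FiniteFirstMoments)
    (hr : Tendsto (fun n => discrepancy (ν n) μ) F (𝓝 0)) :
    Tendsto (fun n => ∑ t, ∑ i, ∫ y, |y| ∂(ν n t i : Measure ℝ)) F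
      (𝓝 (∑ t, ∑ i, ∫ y, |y| ∂(μ t i : Measure ℝ))) :=
  tendsto_finsetSum _ fun t _ => tendsto_finsetSum _ fun i _ =>
    tendsto_integral_abs_of_discrepancy hν hμ hr t i

lemma mem_transportPlans_of_tendsto [F.NeBot] (hν : ∀ n, (ν n).FiniteFirstMoments)
    (hμ : μ.FiniteFirstMoments) (hr : Tendsto (fun n => discrepancy (ν n) μ) F (𝓝 0))
    (hπ : ∀ᶠ n in F, π n ∈ transportPlans (ν n)) (hρ : Tendsto π F (𝓝 ρ)) :
    ρ ∈ transportPlans μ := by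
  refine (mem_transportPlans_iff hμ).2 fun t i => ?_
  have hc : Continuous fun x : PathSpace T d => x t i := by fun_prop
  have hmap : Tendsto (fun n => ν n t i) F (𝓝 (ρ.map hc.aemeasurable)) :=
    (ProbabilityMeasure.tendsto_map_of_tendsto_of_continuous π ρ hρ hc).congr'
      (hπ.mono fun n hn => Subtype.ext (hn.2 t i))
  exact congrArg ProbabilityMeasure.toMeasure
    (tendsto_nhds_unique hmap (tendsto_marginal_of_discrepancy hν hμ hr t i))

lemma tendsto_integral_of_linearGrowth (hν : ∀ n, (ν n).FiniteFirstMoments)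
    (hr : Tendsto (fun n => discrepancy (ν n) μ) F (𝓝 0))
    (hπ : ∀ᶠ n in F, π n ∈ transportPlans (ν n)) (hρμ : ρ ∈ transportPlans μ)
    (hρ : Tendsto π F (𝓝 ρ)) {c : PathSpace T d → ℝ} (hc : Continuous c) {A B : ℝ}
    (hAB : ∀ x, |c x| ≤ A + B * ‖x‖) :
    Tendsto (fun n => ∫ x, c x ∂(π n : Measure (PathSpace T d))) F
      (𝓝 (∫ x, c x ∂(ρ : Measure (PathSpace T d)))) := by
  have hint {κ : Marginals T d} {η : ProbabilityMeasure (PathSpace T d)}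
      (hη : η ∈ transportPlans κ) : Integrable (fun x => A + |B| * ∑ t, ∑ i, |x t i|)
        (η : Measure (PathSpace T d)) :=
    (integrable_const _).add ((integrable_sum_abs_coord hη).const_mul _)
  have hval {κ : Marginals T d} {η : ProbabilityMeasure (PathSpace T d)}
      (hη : η ∈ transportPlans κ) :
      ∫ x, (A + |B| * ∑ t, ∑ i, |x t i|) ∂(η : Measure (PathSpace T d)) =
        A + |B| * ∑ t, ∑ i, ∫ y, |y| ∂(κ t i : Measure ℝ) := by
    rw [integral_add (integrable_const _) ((integrable_sum_abs_coord hη).const_mul _),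
      integral_const_mul, integral_sum_abs_coord hη, integral_const, probReal_univ, one_smul]
  have hcG : ∀ x, |c x| ≤ A + |B| * ∑ t, ∑ i, |x t i| := fun x => (hAB x).trans (by
    gcongr
    exacts [le_abs_self B, norm_le_sum_abs x])
  refine tendsto_integral_of_abs_le hρ hc (by fun_prop) hcG (hint hρμ) (hπ.mono fun n => hint) ?_
  rw [hval hρμ]
  have hμ := finiteFirstMoments_of_mem_transportPlans hρμ
  exact (((tendsto_sum_integral_abs hν hμ hr).const_mul _).const_add _).congr'
    (hπ.mono fun n hn => (hval hn).symm)

lemma mem_relaxedPlans_of_tendsto [F.NeBot] (hν : ∀ n, (ν n).FiniteFirstMoments)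
    (hμ : μ.FiniteFirstMoments) (hr : Tendsto (fun n => discrepancy (ν n) μ) F (𝓝 0))
    (hε : Tendsto ε F (𝓝 ε₀)) (hπ : ∀ᶠ n in F, π n ∈ relaxedPlans (ε n) (ν n))
    (hρ : Tendsto π F (𝓝 ρ)) : ρ ∈ relaxedPlans ε₀ μ := by
  have hplan : ∀ᶠ n in F, π n ∈ transportPlans (ν n) := hπ.mono fun n hn => hn.1
  have hρμ := mem_transportPlans_of_tendsto hν hμ hr hplan hρ
  refine ⟨hρμ, fun s t hst => (martingaleDefect_le_iff hρμ s t).2 fun φ hφ => ?_⟩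
  have hcont : Continuous fun x : PathSpace T d => φ (Preorder.restrictLe s x) ⬝ᵥ (x t - x s) :=
    Continuous.dotProduct (φ.continuous.comp (continuous_pi fun r => continuous_apply _))
      (by fun_prop)
  have hgrowth (x : PathSpace T d) :
      |φ (Preorder.restrictLe s x) ⬝ᵥ (x t - x s)| ≤ 0 + d * 2 * ‖x‖ := by
    have hterm (i : Fin d) : |(x t - x s) i| ≤ 2 * ‖x‖ :=
      (norm_le_pi_norm (x t - x s) i).trans ((norm_sub_le _ _).trans
        (by linarith [norm_le_pi_norm x t, norm_le_pi_norm x s]))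
    refine (abs_dotProduct_le_sum_abs ((φ.norm_coe_le_norm _).trans hφ) _).trans
      ((Finset.sum_le_sum fun i _ => hterm i).trans_eq ?_)
    simp [mul_assoc]
  exact le_of_tendsto_of_tendsto
    (tendsto_integral_of_linearGrowth hν hr hplan hρμ hρ hcont hgrowth) hε
    (hπ.mono fun n hn => (martingaleDefect_le_iff hn.1 s t).1 (hn.2 s t hst) φ hφ)

lemma exists_tendsto_of_relaxedPlans {F : Ultrafilter ι} (hν : ∀ n, (ν n).FiniteFirstMoments)
    (hμ : μ.FiniteFirstMoments) (hr : Tendsto (fun n => discrepancy (ν n) μ) F (𝓝 0))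
    (hε : Tendsto ε F (𝓝 ε₀)) (hπ : ∀ᶠ n in F, π n ∈ relaxedPlans (ε n) (ν n)) :
    ∃ ρ ∈ relaxedPlans ε₀ μ, Tendsto π F (𝓝 ρ) := by
  set C := ∑ t, ∑ i, ∫ y, |y| ∂(μ t i : Measure ℝ)
  have hbound : ∀ᶠ n in (F : Filter ι),
      ∫⁻ x, ‖x‖ₑ ∂(π n : Measure (PathSpace T d)) ≤ ENNReal.ofReal (C + 1) := by
    filter_upwards [hπ, (tendsto_sum_integral_abs hν hμ hr).eventually_le_const (lt_add_one C)]
      with n hn hC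
    exact (lintegral_enorm_le_of_mem_transportPlans hn.1).trans (ENNReal.ofReal_le_ofReal hC)
  obtain ⟨ρ, -, hρ⟩ :=
    (isCompact_setOf_lintegral_enorm_le ENNReal.ofReal_ne_top).ultrafilter_le_nhds
      (F.map π) (le_principal_iff.2 hbound)
  exact ⟨ρ, mem_relaxedPlans_of_tendsto hν hμ hr hε hπ hρ, hρ⟩

lemma isCompact_relaxedPlans (hμ : μ.FiniteFirstMoments) (ε₀ : ℝ) :
    IsCompact (relaxedPlans ε₀ μ) :=
  isCompact_iff_ultrafilter_le_nhds.2 fun F hF =>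
    exists_tendsto_of_relaxedPlans (π := id) (fun _ => hμ) hμ
      (by simpa only [discrepancy_self] using tendsto_const_nhds) tendsto_const_nhds
      (le_principal_iff.1 hF)

lemma continuousOn_integral_transportPlans {c : PathSpace T d → ℝ} (hc : Continuous c) {A B : ℝ}
    (hAB : ∀ x, |c x| ≤ A + B * ‖x‖) (μ : Marginals T d) :
    ContinuousOn (fun π : ProbabilityMeasure (PathSpace T d) =>
      ∫ x, c x ∂(π : Measure (PathSpace T d))) (transportPlans μ) := fun _ hρ =>
  tendsto_integral_of_linearGrowth (ν := fun _ => μ) (π := id)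
    (fun _ => finiteFirstMoments_of_mem_transportPlans hρ)
    (by simpa only [discrepancy_self] using tendsto_const_nhds) eventually_mem_nhdsWithin hρ
    nhdsWithin_le_nhds hc hAB

lemma isTightMeasureSet_range_of_mem_transportPlans {ν : ℕ → Marginals T d}
    {π : ℕ → ProbabilityMeasure (PathSpace T d)} (hν : ∀ n, (ν n).FiniteFirstMoments)
    (hμ : μ.FiniteFirstMoments) (hr : Tendsto (fun n => discrepancy (ν n) μ) atTop (𝓝 0))
    (hπ : ∀ n, π n ∈ transportPlans (ν n)) :
    IsTightMeasureSet (Set.range fun n => (π n : Measure (PathSpace T d))) := by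
  obtain ⟨C, hC⟩ := (tendsto_sum_integral_abs hν hμ hr).bddAbove_range
  refine (isTightMeasureSet_setOf_lintegral_enorm_le (ENNReal.ofReal_ne_top (r := C))).subset ?_
  rintro _ ⟨n, rfl⟩
  exact (lintegral_enorm_le_of_mem_transportPlans (hπ n)).trans
    (ENNReal.ofReal_le_ofReal (hC ⟨n, rfl⟩))

end Limits

section Optimization

variable {T d : ℕ} {c : PathSpace T d → ℝ} {S : Set (ProbabilityMeasure (PathSpace T d))}
  {ρ : ProbabilityMeasure (PathSpace T d)}

lemma le_upperValue (hρ : ρ ∈ S) :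
    ((∫ x, c x ∂(ρ : Measure (PathSpace T d)) : ℝ) : EReal) ≤ upperValue c S :=
  le_iSup₂ (f := fun (η : ProbabilityMeasure (PathSpace T d)) (_ : η ∈ S) =>
    ((∫ x, c x ∂(η : Measure (PathSpace T d)) : ℝ) : EReal)) ρ hρ

lemma isMaximizer_iff : IsMaximizer c S ρ ↔
    ρ ∈ S ∧ IsMaxOn (fun η : ProbabilityMeasure (PathSpace T d) =>
      ∫ x, c x ∂(η : Measure (PathSpace T d))) S ρ :=
  and_congr_right fun hρ =>
    ⟨fun h _ hη => EReal.coe_le_coe_iff.1 ((le_upperValue hη).trans_eq h.symm),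
      fun h => (le_upperValue hρ).antisymm (iSup₂_le fun _ hη => EReal.coe_le_coe_iff.2 (h hη))⟩

lemma exists_isMaximizer (hS : IsCompact S) (hne : S.Nonempty)
    (hc : ContinuousOn (fun η : ProbabilityMeasure (PathSpace T d) =>
      ∫ x, c x ∂(η : Measure (PathSpace T d))) S) : ∃ η, IsMaximizer c S η :=
  (hS.exists_isMaxOn hne hc).imp fun _ => isMaximizer_iff.2

lemma lowerValue_eq_neg_upperValue (c : PathSpace T d → ℝ)
    (S : Set (ProbabilityMeasure (PathSpace T d))) :
    lowerValue c S = -upperValue (fun x => -c x) S := by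
  apply le_antisymm
  · refine EReal.le_neg_of_le_neg (iSup₂_le fun η hη => ?_)
    rw [integral_neg, EReal.coe_neg]
    exact EReal.neg_le_neg_iff.2 (iInf₂_le η hη)
  · refine le_iInf₂ fun η hη => EReal.neg_le_of_neg_le ?_
    rw [← EReal.coe_neg, ← integral_neg]
    exact le_upperValue hη

lemma isMinimizer_iff_isMaximizer_neg :
    IsMinimizer c S ρ ↔ IsMaximizer (fun x => -c x) S ρ := by
  refine and_congr_right fun _ => ?_
  rw [lowerValue_eq_neg_upperValue, integral_neg, EReal.coe_neg, neg_eq_iff_eq_neg]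

variable {ι : Type*} {F : Filter ι} {μ : Marginals T d} {ν : ι → Marginals T d}
  {ε : ι → ℝ} {A B : ℝ} {π : ι → ProbabilityMeasure (PathSpace T d)}

lemma isMaximizer_of_tendsto [F.NeBot] (hν : ∀ n, (ν n).FiniteFirstMoments)
    (hμ : μ.FiniteFirstMoments) (hr : Tendsto (fun n => discrepancy (ν n) μ) F (𝓝 0))
    (hc : Continuous c) (hAB : ∀ x, |c x| ≤ A + B * ‖x‖) (hε : Tendsto ε F (𝓝 0))
    (hrε : ∀ n, discrepancy (ν n) μ ≤ ε n)
    (hπ : ∀ n, IsMaximizer c (relaxedPlans (ε n) (ν n)) (π n)) (hρ : Tendsto π F (𝓝 ρ)) :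
    IsMaximizer c (martingalePlans μ) ρ := by
  have hmem : ρ ∈ martingalePlans μ := by
    rw [martingalePlans_eq_relaxedPlans_zero]
    exact mem_relaxedPlans_of_tendsto hν hμ hr hε (.of_forall fun n => (hπ n).1) hρ
  refine isMaximizer_iff.2 ⟨hmem, fun η hη => ?_⟩
  obtain ⟨η', hη', hlim⟩ := exists_tendsto_relaxedPlans hη hν hr
  exact le_of_tendsto_of_tendsto'
    (tendsto_integral_of_linearGrowth hν hr (.of_forall fun n => (hη' n).1) hη.1 hlim hc hAB)
    (tendsto_integral_of_linearGrowth hν hr (.of_forall fun n => (hπ n).1.1) hmem.1 hρ hc hAB)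
    fun n => (isMaximizer_iff.1 (hπ n)).2 (relaxedPlans_mono (hrε n) (hη' n))

lemma exists_tendsto_isMaximizer {F : Ultrafilter ι} (hν : ∀ n, (ν n).FiniteFirstMoments)
    (hμ : μ.FiniteFirstMoments) (hr : Tendsto (fun n => discrepancy (ν n) μ) F (𝓝 0))
    (hc : Continuous c) (hAB : ∀ x, |c x| ≤ A + B * ‖x‖) (hε : Tendsto ε F (𝓝 0))
    (hrε : ∀ n, discrepancy (ν n) μ ≤ ε n)
    (hπ : ∀ n, IsMaximizer c (relaxedPlans (ε n) (ν n)) (π n)) :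
    ∃ ρ, IsMaximizer c (martingalePlans μ) ρ ∧ Tendsto π F (𝓝 ρ) := by
  obtain ⟨ρ, -, hρ⟩ :=
    exists_tendsto_of_relaxedPlans hν hμ hr hε (.of_forall fun n => (hπ n).1)
  exact ⟨ρ, isMaximizer_of_tendsto hν hμ hr hc hAB hε hrε hπ hρ, hρ⟩

lemma tendsto_upperValue (hν : ∀ n, (ν n).FiniteFirstMoments) (hμ : μ.FiniteFirstMoments)
    (hr : Tendsto (fun n => discrepancy (ν n) μ) F (𝓝 0)) (hc : Continuous c)
    (hAB : ∀ x, |c x| ≤ A + B * ‖x‖) (hε : Tendsto ε F (𝓝 0))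
    (hrε : ∀ n, discrepancy (ν n) μ ≤ ε n)
    (hπ : ∀ n, IsMaximizer c (relaxedPlans (ε n) (ν n)) (π n)) :
    Tendsto (fun n => upperValue c (relaxedPlans (ε n) (ν n))) F
      (𝓝 (upperValue c (martingalePlans μ))) := by
  refine (tendsto_iff_ultrafilter _ _ _).2 fun G hG => ?_
  obtain ⟨ρ, hρ, hlim⟩ := exists_tendsto_isMaximizer hν hμ (hr.mono_left hG) hc hAB
    (hε.mono_left hG) hrε hπ
  rw [← hρ.2, ← funext fun n => (hπ n).2]
  exact (continuous_coe_real_ereal.tendsto _).comp (tendsto_integral_of_linearGrowth hν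
    (hr.mono_left hG) (.of_forall fun n => (hπ n).1.1) hρ.1.1 hlim hc hAB)

lemma tendsto_of_unique_isMaximizer (hν : ∀ n, (ν n).FiniteFirstMoments)
    (hμ : μ.FiniteFirstMoments) (hr : Tendsto (fun n => discrepancy (ν n) μ) F (𝓝 0))
    (hc : Continuous c) (hAB : ∀ x, |c x| ≤ A + B * ‖x‖) (hε : Tendsto ε F (𝓝 0))
    (hrε : ∀ n, discrepancy (ν n) μ ≤ ε n)
    (hπ : ∀ n, IsMaximizer c (relaxedPlans (ε n) (ν n)) (π n))
    (huniq : ∀ ρ', IsMaximizer c (martingalePlans μ) ρ' → ρ' = ρ) : Tendsto π F (𝓝 ρ) := by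
  refine (tendsto_iff_ultrafilter _ _ _).2 fun G hG => ?_
  obtain ⟨ρ', hρ', hlim⟩ := exists_tendsto_isMaximizer hν hμ (hr.mono_left hG) hc hAB
    (hε.mono_left hG) hrε hπ
  exact huniq ρ' hρ' ▸ hlim

lemma exists_isMaximizer_martingalePlans (hμ : μ.FiniteFirstMoments)
    (hM : (martingalePlans μ).Nonempty) (hc : Continuous c) (hAB : ∀ x, |c x| ≤ A + B * ‖x‖) :
    ∃ ρ, IsMaximizer c (martingalePlans μ) ρ := by
  rw [martingalePlans_eq_relaxedPlans_zero] at hM ⊢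
  exact exists_isMaximizer (isCompact_relaxedPlans hμ 0) hM
    ((continuousOn_integral_transportPlans hc hAB μ).mono fun _ h => h.1)

lemma stability_of_maximization {ν : ℕ → Marginals T d} {ε : ℕ → ℝ}
    (hM : (martingalePlans μ).Nonempty) (hν : ∀ n, (ν n).FiniteFirstMoments)
    (hr : Tendsto (fun n => discrepancy (ν n) μ) atTop (𝓝 0)) (hc : Continuous c)
    (hAB : ∀ x, |c x| ≤ A + B * ‖x‖) (hε : Tendsto ε atTop (𝓝 0))
    (hrε : ∀ n, discrepancy (ν n) μ ≤ ε n) :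
    Tendsto (fun n => upperValue c (relaxedPlans (ε n) (ν n))) atTop
        (𝓝 (upperValue c (martingalePlans μ))) ∧
      (upperValue c (martingalePlans μ) ≠ ⊤ ∧ upperValue c (martingalePlans μ) ≠ ⊥) ∧
      (∀ n, ∃ π, IsMaximizer c (relaxedPlans (ε n) (ν n)) π) ∧
      ∀ π : ℕ → ProbabilityMeasure (PathSpace T d),
        (∀ n, IsMaximizer c (relaxedPlans (ε n) (ν n)) (π n)) →
          IsTightMeasureSet (Set.range fun n => (π n : Measure (PathSpace T d))) ∧
          (∀ ρ, MapClusterPt ρ atTop π → IsMaximizer c (martingalePlans μ) ρ) ∧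
          (∀ ρ, IsMaximizer c (martingalePlans μ) ρ →
            (∀ ρ', IsMaximizer c (martingalePlans μ) ρ' → ρ' = ρ) → Tendsto π atTop (𝓝 ρ)) := by
  have hμ : μ.FiniteFirstMoments :=
    hM.elim fun _ hη => finiteFirstMoments_of_mem_transportPlans hη.1
  have hex : ∀ n, ∃ π, IsMaximizer c (relaxedPlans (ε n) (ν n)) π := fun n =>
    exists_isMaximizer (isCompact_relaxedPlans (hν n) (ε n))
      (nonempty_relaxedPlans hM (hν n) (hrε n))
      ((continuousOn_integral_transportPlans hc hAB (ν n)).mono fun _ h => h.1)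
  choose π₀ hπ₀ using hex
  obtain ⟨ρ₀, hρ₀⟩ := exists_isMaximizer_martingalePlans hμ hM hc hAB
  refine ⟨tendsto_upperValue hν hμ hr hc hAB hε hrε hπ₀, ?_, fun n => ⟨π₀ n, hπ₀ n⟩, fun π hπ =>
    ⟨isTightMeasureSet_range_of_mem_transportPlans hν hμ hr fun n => (hπ n).1.1, fun ρ hρ => ?_,
      fun _ _ huniq => tendsto_of_unique_isMaximizer hν hμ hr hc hAB hε hrε hπ huniq⟩⟩
  · rw [← hρ₀.2]
    exact ⟨EReal.coe_ne_top _, EReal.coe_ne_bot _⟩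
  · obtain ⟨G, hG, hlim⟩ := mapClusterPt_iff_ultrafilter.1 hρ
    exact isMaximizer_of_tendsto hν hμ (hr.mono_left hG) hc hAB (hε.mono_left hG) hrε hπ hlim

end Optimization

end MMOT

theorem theorem3p1_general {T d : ℕ} (μ : MMOT.Marginals T d)
    (hM : (MMOT.martingalePlans μ).Nonempty)
    (μn : ℕ → MMOT.Marginals T d) (hμn : ∀ n, (μn n).FiniteFirstMoments)
    (hr : Tendsto (fun n => MMOT.discrepancy (μn n) μ) atTop (𝓝 0)) :
    (∀ n, (MMOT.relaxedPlans (MMOT.discrepancy (μn n) μ) (μn n)).Nonempty) ∧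
    ∀ c : MMOT.PathSpace T d → ℝ, Continuous c → (∃ A B, ∀ x, |c x| ≤ A + B * ‖x‖) →
      ∀ ε : ℕ → ℝ, Tendsto ε atTop (𝓝 0) → (∀ n, MMOT.discrepancy (μn n) μ ≤ ε n) →
        (Tendsto (fun n => MMOT.upperValue c (MMOT.relaxedPlans (ε n) (μn n))) atTop
            (𝓝 (MMOT.upperValue c (MMOT.martingalePlans μ))) ∧
          Tendsto (fun n => MMOT.lowerValue c (MMOT.relaxedPlans (ε n) (μn n))) atTop
            (𝓝 (MMOT.lowerValue c (MMOT.martingalePlans μ))) ∧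
          (MMOT.upperValue c (MMOT.martingalePlans μ) ≠ ⊤ ∧
            MMOT.upperValue c (MMOT.martingalePlans μ) ≠ ⊥) ∧
          (MMOT.lowerValue c (MMOT.martingalePlans μ) ≠ ⊤ ∧
            MMOT.lowerValue c (MMOT.martingalePlans μ) ≠ ⊥)) ∧
        ((∀ n, ∃ π, MMOT.IsMaximizer c (MMOT.relaxedPlans (ε n) (μn n)) π) ∧
          ∀ π : ℕ → ProbabilityMeasure (MMOT.PathSpace T d),
            (∀ n, MMOT.IsMaximizer c (MMOT.relaxedPlans (ε n) (μn n)) (π n)) →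
              IsTightMeasureSet
                (Set.range fun n => (π n : Measure (MMOT.PathSpace T d))) ∧
              (∀ ρ, MapClusterPt ρ atTop π →
                MMOT.IsMaximizer c (MMOT.martingalePlans μ) ρ) ∧
              (∀ ρ, MMOT.IsMaximizer c (MMOT.martingalePlans μ) ρ →
                (∀ ρ', MMOT.IsMaximizer c (MMOT.martingalePlans μ) ρ' → ρ' = ρ) →
                Tendsto π atTop (𝓝 ρ))) ∧
        ((∀ n, ∃ π, MMOT.IsMinimizer c (MMOT.relaxedPlans (ε n) (μn n)) π) ∧
          ∀ π : ℕ → ProbabilityMeasure (MMOT.PathSpace T d),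
            (∀ n, MMOT.IsMinimizer c (MMOT.relaxedPlans (ε n) (μn n)) (π n)) →
              IsTightMeasureSet
                (Set.range fun n => (π n : Measure (MMOT.PathSpace T d))) ∧
              (∀ ρ, MapClusterPt ρ atTop π →
                MMOT.IsMinimizer c (MMOT.martingalePlans μ) ρ) ∧
              (∀ ρ, MMOT.IsMinimizer c (MMOT.martingalePlans μ) ρ →
                (∀ ρ', MMOT.IsMinimizer c (MMOT.martingalePlans μ) ρ' → ρ' = ρ) →
                Tendsto π atTop (𝓝 ρ))) := by
  refine ⟨fun n => MMOT.nonempty_relaxedPlans hM (hμn n) le_rfl,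
    fun c hc ⟨A, B, hAB⟩ ε hε hrε => ?_⟩
  obtain ⟨hv, hfin, hmax⟩ := MMOT.stability_of_maximization hM hμn hr hc hAB hε hrε
  obtain ⟨hv', hfin', hmin⟩ := MMOT.stability_of_maximization hM hμn hr hc.neg
    (fun x => (abs_neg (c x)).trans_le (hAB x)) hε hrε
  simp only [MMOT.lowerValue_eq_neg_upperValue, MMOT.isMinimizer_iff_isMaximizer_neg]
  exact ⟨⟨hv, (continuous_neg.tendsto _).comp hv', hfin, mt EReal.neg_eq_top_iff.1 hfin'.2,
    mt EReal.neg_eq_bot_iff.1 hfin'.1⟩, hmax, hmin⟩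

theorem theorem3p1 {T d : ℕ} (μ : MMOT.Marginals T d) (hμ : μ.FiniteFirstMoments)
    (hM : (MMOT.martingalePlans μ).Nonempty)
    (μn : ℕ → MMOT.Marginals T d) (hμn : ∀ n, (μn n).FiniteFirstMoments)
    (hr : Tendsto (fun n => MMOT.discrepancy (μn n) μ) atTop (𝓝 0)) :
    (∀ n, (MMOT.relaxedPlans (MMOT.discrepancy (μn n) μ) (μn n)).Nonempty) ∧
    ∀ c : MMOT.PathSpace T d → ℝ, (∃ L, LipschitzWith L c) →
      ∀ ε : ℕ → ℝ, Tendsto ε atTop (𝓝 0) → (∀ n, MMOT.discrepancy (μn n) μ ≤ ε n) →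
        -- (i) convergence of the values, which are finite in the limit
        (Tendsto (fun n => MMOT.upperValue c (MMOT.relaxedPlans (ε n) (μn n))) atTop
            (𝓝 (MMOT.upperValue c (MMOT.martingalePlans μ))) ∧
          Tendsto (fun n => MMOT.lowerValue c (MMOT.relaxedPlans (ε n) (μn n))) atTop
            (𝓝 (MMOT.lowerValue c (MMOT.martingalePlans μ))) ∧
          (MMOT.upperValue c (MMOT.martingalePlans μ) ≠ ⊤ ∧
            MMOT.upperValue c (MMOT.martingalePlans μ) ≠ ⊥) ∧
          (MMOT.lowerValue c (MMOT.martingalePlans μ) ≠ ⊤ ∧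
            MMOT.lowerValue c (MMOT.martingalePlans μ) ≠ ⊥)) ∧
        -- (ii) for the maximization problems
        ((∀ n, ∃ π, MMOT.IsMaximizer c (MMOT.relaxedPlans (ε n) (μn n)) π) ∧
          ∀ π : ℕ → ProbabilityMeasure (MMOT.PathSpace T d),
            (∀ n, MMOT.IsMaximizer c (MMOT.relaxedPlans (ε n) (μn n)) (π n)) →
              IsTightMeasureSet
                (Set.range fun n => (π n : Measure (MMOT.PathSpace T d))) ∧
              (∀ ρ, MapClusterPt ρ atTop π →
                MMOT.IsMaximizer c (MMOT.martingalePlans μ) ρ) ∧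
              (∀ ρ, MMOT.IsMaximizer c (MMOT.martingalePlans μ) ρ →
                (∀ ρ', MMOT.IsMaximizer c (MMOT.martingalePlans μ) ρ' → ρ' = ρ) →
                Tendsto π atTop (𝓝 ρ))) ∧
        -- (ii) for the minimization problems
        ((∀ n, ∃ π, MMOT.IsMinimizer c (MMOT.relaxedPlans (ε n) (μn n)) π) ∧
          ∀ π : ℕ → ProbabilityMeasure (MMOT.PathSpace T d),
            (∀ n, MMOT.IsMinimizer c (MMOT.relaxedPlans (ε n) (μn n)) (π n)) →
              IsTightMeasureSet
                (Set.range fun n => (π n : Measure (MMOT.PathSpace T d))) ∧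
              (∀ ρ, MapClusterPt ρ atTop π →
                MMOT.IsMinimizer c (MMOT.martingalePlans μ) ρ) ∧
              (∀ ρ, MMOT.IsMinimizer c (MMOT.martingalePlans μ) ρ →
                (∀ ρ', MMOT.IsMinimizer c (MMOT.martingalePlans μ) ρ' → ρ' = ρ) →
                Tendsto π atTop (𝓝 ρ))) :=
  let ⟨hne, h⟩ := theorem3p1_general μ hM μn hμn hr
  ⟨hne, fun c ⟨_, hc⟩ => h c hc.continuous ⟨_, _, MMOT.abs_le_of_lipschitzWith hc⟩⟩
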